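/- Let $B$ be a (not necessarily unital) $C^*$-algebra and let $Z$ be a right Hilbert $C^*$-module over $B$, with $B$-valued inner product $\langle\cdot,\cdot\rangle$ linear in the second variable. A maximal right submodule of $Z$ is a maximal element, with respect to inclusion, among the proper norm-closed right $B$-submodules (complex subspaces stable under $B$) of $Z$. A right submodule $W$ is algebraically finitely generated if there are finitely many $w_1,\dots,w_N\in W$ such that every element of $W$ is of the form $\sum_{i=1}^N w_i a_i$ with $a_i$ in the unitization $B^1$ of $B$. Then the following are equivalent: (1) every maximal right submodule of $Z$ is algebraically finitely generated over $B$; (2) there are positive integers $m,n_1,\dots,n_m$ and complex Hilbert spaces $H_1,\dots,H_m$ (possibly zero) such that $Z\cong\bigoplus_{k=1}^m B(H_k,\mathbb{C}^{n_k})$ as TROs (ternary rings of operators), where $B(H_k,\mathbb{C}^{n_k})$ is the space of bounded operators from $H_k$ to $\mathbb{C}^{n_k}$; that is, there is a complex-linear bijection $T\colon Z\to\bigoplus_{k=1}^m B(H_k,\mathbb{C}^{n_k})$ with $T(x\langle y,z\rangle)=T(x)\,T(y)^*\,T(z)$ for all $x,y,z\in Z$, the operations on the right being taken in each summand. -/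

import Mathlib

open MulOpposite
open scoped RightActions

universe u v

/-!
A right Hilbert C⋆-module over a C⋆-algebra `B` (possibly without unit) is a complete
`CStarModule Bᵐᵒᵖ Z`: an action of `Bᵐᵒᵖ` on `Z` is a right action `z <• b = op b • z` of `B`.
The assumption `StarOrderedRing B` says that the order on `B` is the usual order of a C⋆-algebra.
-/

namespace RightHilbert

section Module

variable (B : Type*) {Z : Type*} [NonUnitalCStarAlgebra B] [PartialOrder B]
  [NormedAddCommGroup Z] [NormedSpace ℂ Z] [SMul Bᵐᵒᵖ Z] [CStarModule Bᵐᵒᵖ Z]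

/-- The `B`-valued inner product `⟨x, y⟩ = x⋆ y` of a right Hilbert C⋆-module; it is conjugate
linear in `x` and linear in `y`. -/
def inn (x y : Z) : B := unop (inner Bᵐᵒᵖ x y)

theorem inn_smul_right (x y : Z) (b : B) : inn B x (y <• b) = inn B x y * b := by
  simp [inn]

theorem inn_smul_left (x y : Z) (b : B) : inn B (x <• b) y = star b * inn B x y := by
  simp [inn]

theorem star_inn (x y : Z) : star (inn B x y) = inn B y x := by
  rw [inn, ← unop_star, CStarModule.star_inner, inn]

theorem inn_self_nonneg (x : Z) : 0 ≤ inn B x x :=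
  CStarModule.inner_self_nonneg (A := Bᵐᵒᵖ) (x := x)

theorem norm_eq_sqrt_norm_inn (x : Z) : ‖x‖ = √‖inn B x x‖ :=
  CStarModule.norm_eq_sqrt_norm_inner_self (A := Bᵐᵒᵖ) x

/-- The ternary product `x y⋆ z = x ⟨y, z⟩` of a right Hilbert C⋆-module, which is the one that it
has as a corner of its linking algebra. -/
def triple (x y z : Z) : Z := x <• inn B y z

/-- Closed right `B`-submodules of `Z`: norm closed complex subspaces that are stable under the
right action of `B`. -/
def IsClosedRightSubmodule (W : Submodule ℂ Z) : Prop :=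
  IsClosed (W : Set Z) ∧ ∀ z ∈ W, ∀ b : B, z <• b ∈ W

/-- Maximal right submodules: the maximal elements, with respect to inclusion, among the proper
closed right submodules. -/
def IsMaximalRightSubmodule (W : Submodule ℂ Z) : Prop :=
  Maximal (fun V : Submodule ℂ Z => IsClosedRightSubmodule B V ∧ V ≠ ⊤) W

/-- `W` is algebraically finitely generated over `B`: there are finitely many `w i ∈ W` such that
every element of `W` is a finite sum `∑ i, w i a i` with `a i = c i 1 + b i` in the unitization
of `B`. -/
def IsAlgFinitelyGenerated (W : Submodule ℂ Z) : Prop :=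
  ∃ (N : ℕ) (w : Fin N → Z), (∀ i, w i ∈ W) ∧
    ∀ z ∈ W, ∃ (c : Fin N → ℂ) (b : Fin N → B), z = ∑ i, (c i • w i + w i <• b i)

end Module

section Blocks

variable {m : ℕ} (n : Fin m → ℕ) (H : Fin m → Type u) [∀ k, NormedAddCommGroup (H k)]
  [∀ k, InnerProductSpace ℂ (H k)] [∀ k, CompleteSpace (H k)]

/-- The finite direct sum of the spaces `B(H k, ℂ ^ n k)` of bounded operators from the Hilbert
space `H k` to `ℂ ^ n k` (with its Euclidean norm). -/
abbrev BlockSum : Type u := (k : Fin m) → (H k →L[ℂ] EuclideanSpace ℂ (Fin (n k)))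

/-- The ternary product `x y⋆ z` of operators, block by block. -/
noncomputable def blockTriple (x y z : BlockSum n H) : BlockSum n H :=
  fun k => x k ∘L (ContinuousLinearMap.adjoint (y k)) ∘L z k

end Blocks

end RightHilbert

/-!
Write `θ x y` for the rank one operator `z ↦ x ⟨y, z⟩` on `Z`, called `rankOne B x y` below.

Suppose that all maximal right submodules are finitely generated.

* A closed finitely generated submodule `W` is complemented. By the open mapping theorem the operator
  `G = ∑ i, θ (w i) (w i)` of a family of generators is bounded below on `W`, and since it is
  positive it is invertible there, so that `W` has a finite frame `w i`, `G⁻¹ (w i)`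
  (`IsAlgFinitelyGenerated.exists_frame`).
* If `‖v‖ = 1`, then the range of `1 - θ v v` is a proper right submodule, because `1 - ⟨v, v⟩` is
  not invertible. Modulo this range the identity is a finite rank operator, and a perturbation
  argument shows that proper submodules containing it have proper closures, and lie in maximal ones
  (`exists_isMaximalRightSubmodule_ge`). In particular, if `Z ≠ 0`, there is a maximal submodule
  `W`. If moreover `v` is orthogonal to `W`, then `W` is the closure of the range of `1 - θ v v`.
  So `θ v v` is the identity on the complement of `W`, for each of its unit vectors `v`: these are
  minimal vectors (`IsMaximalRightSubmodule.isMinimalVector`), and by polarization all rank one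
  operators are scalars on this complement, which makes it a Hilbert space.
* Now `Z` itself has a finite frame, so every proper right submodule is contained in a maximal one.
  Hence a maximal orthogonal system of minimal vectors spans `Z`, and since `Z` has a finite frame
  finitely many vectors suffice (`exists_isMinimalSystem_sum_rankOne_eq`). The system can be chosen
  such that the projections `⟨e, e⟩` of its elements are pairwise equal or centrally orthogonal.
  The elements with a given projection make up the rows of one block
  (`exists_linearEquiv_blockSum`).

Conversely, every right submodule `W` of a sum of blocks `B(H k, ℂ ^ n k)`, closed or not, is
finitely generated. Fix unit vectors `h k` in the nonzero spaces `H k`. An element of a block has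
finite rank, so it is a sum of operators `v ⟪g, ·⟫`, which are multiples of `v ⟪h k, ·⟫`, and the
operators of the latter form in `W` make up a finite dimensional space
(`isAlgFinitelyGenerated_of_linearEquiv_blockSum`).
-/

namespace RightHilbert

/-! ### Inner product, right action and rank one operators -/

section Basic

variable (B : Type*) {Z : Type*} [NonUnitalCStarAlgebra B] [PartialOrder B]
  [NormedAddCommGroup Z] [NormedSpace ℂ Z] [SMul Bᵐᵒᵖ Z] [CStarModule Bᵐᵒᵖ Z]

theorem inn_add_right (x y z : Z) : inn B x (y + z) = inn B x y + inn B x z := by simp [inn]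

theorem inn_add_left (x y z : Z) : inn B (x + y) z = inn B x z + inn B y z := by simp [inn]

theorem inn_sub_right (x y z : Z) : inn B x (y - z) = inn B x y - inn B x z := by simp [inn]

theorem inn_sub_left (x y z : Z) : inn B (x - y) z = inn B x z - inn B y z := by simp [inn]

theorem inn_csmul_right (c : ℂ) (x y : Z) : inn B x (c • y) = c • inn B x y := by simp [inn]

theorem inn_csmul_left (c : ℂ) (x y : Z) : inn B (c • x) y = star c • inn B x y := by simp [inn]

theorem inn_zero_right (x : Z) : inn B x 0 = 0 := by simp [inn]

theorem inn_sum_right {ι : Type*} (s : Finset ι) (x : Z) (f : ι → Z) :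
    inn B x (∑ i ∈ s, f i) = ∑ i ∈ s, inn B x (f i) := by simp [inn]

theorem inn_sum_left {ι : Type*} (s : Finset ι) (x : Z) (f : ι → Z) :
    inn B (∑ i ∈ s, f i) x = ∑ i ∈ s, inn B (f i) x := by simp [inn]

variable {B} in
theorem inn_eq_zero_comm {x y : Z} : inn B x y = 0 ↔ inn B y x = 0 := by
  rw [← star_inn B y x, star_eq_zero]

variable {B} in
theorem inn_self_eq_zero {x : Z} : inn B x x = 0 ↔ x = 0 := by
  rw [← CStarModule.inner_self (A := Bᵐᵒᵖ) (x := x), inn, unop_eq_zero_iff]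

theorem norm_sq_eq_norm_inn (x : Z) : ‖x‖ ^ 2 = ‖inn B x x‖ :=
  CStarModule.norm_sq_eq (A := Bᵐᵒᵖ)

/-- Vectors are determined by their inner products; the module axioms of the right action follow
from this. -/
theorem ext_inn_left {x y : Z} (h : ∀ w, inn B w x = inn B w y) : x = y := by
  rw [← sub_eq_zero, ← inn_self_eq_zero (B := B), inn_sub_right, h, sub_self]

theorem ract_add (x y : Z) (b : B) : (x + y) <• b = x <• b + y <• b :=
  ext_inn_left B fun w => by simp [inn_smul_right, inn_add_right, add_mul]

theorem ract_sub (x y : Z) (b : B) : (x - y) <• b = x <• b - y <• b :=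
  ext_inn_left B fun w => by simp [inn_smul_right, inn_sub_right, sub_mul]

theorem ract_add_right (x : Z) (b c : B) : x <• (b + c) = x <• b + x <• c :=
  ext_inn_left B fun w => by simp [inn_smul_right, inn_add_right, mul_add, -op_add]

theorem ract_mul (x : Z) (b c : B) : x <• (b * c) = x <• b <• c :=
  ext_inn_left B fun w => by simp [inn_smul_right, mul_assoc, -op_mul]

theorem ract_csmul (z : ℂ) (x : Z) (b : B) : (z • x) <• b = z • (x <• b) :=
  ext_inn_left B fun w => by
    rw [inn_smul_right, inn_csmul_right, inn_csmul_right, inn_smul_right, smul_mul_assoc]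

theorem ract_csmul_right (z : ℂ) (x : Z) (b : B) : x <• (z • b) = z • (x <• b) :=
  ext_inn_left B fun w => by
    rw [inn_smul_right, inn_csmul_right, inn_smul_right, mul_smul_comm]

theorem ract_zero (x : Z) : x <• (0 : B) = 0 :=
  ext_inn_left B fun w => by simp [inn_smul_right, inn_zero_right, -op_zero]

theorem zero_ract (b : B) : (0 : Z) <• b = 0 :=
  ext_inn_left B fun w => by simp [inn_smul_right, inn_zero_right]

theorem ract_sum {ι : Type*} (s : Finset ι) (x : Z) (f : ι → B) :
    x <• (∑ i ∈ s, f i) = ∑ i ∈ s, x <• f i :=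
  ext_inn_left B fun w => by
    rw [inn_smul_right, inn_sum_right, Finset.mul_sum]; simp only [inn_smul_right]

theorem sum_ract {ι : Type*} (s : Finset ι) (b : B) (f : ι → Z) :
    (∑ i ∈ s, f i) <• b = ∑ i ∈ s, f i <• b :=
  ext_inn_left B fun w => by
    simp only [inn_smul_right, inn_sum_right, Finset.sum_mul]

theorem norm_ract_le (x : Z) (b : B) : ‖x <• b‖ ≤ ‖x‖ * ‖b‖ := by
  refine (pow_le_pow_iff_left₀ (norm_nonneg _) (by positivity) two_ne_zero).mp ?_
  rw [norm_sq_eq_norm_inn B, inn_smul_right, inn_smul_left, mul_pow, norm_sq_eq_norm_inn B x]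
  calc ‖star b * inn B x x * b‖ ≤ ‖star b‖ * ‖inn B x x‖ * ‖b‖ := by
        refine (norm_mul_le _ _).trans ?_
        gcongr
        exact norm_mul_le _ _
    _ = ‖inn B x x‖ * ‖b‖ ^ 2 := by rw [norm_star]; ring

/-- The right action as a continuous linear map in the algebra variable. -/
noncomputable def ractCLM (x : Z) : B →L[ℂ] Z :=
  LinearMap.mkContinuous
    { toFun := fun b => x <• b
      map_add' := ract_add_right B x
      map_smul' := fun z b => ract_csmul_right B z x b } ‖x‖ fun b => norm_ract_le B x b

@[simp] theorem ractCLM_apply (x : Z) (b : B) : ractCLM B x b = x <• b := rfl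

/-- The action of a fixed algebra element as a continuous linear map. -/
noncomputable def ractByCLM (b : B) : Z →L[ℂ] Z :=
  LinearMap.mkContinuous
    { toFun := fun x => x <• b
      map_add' := fun x y => ract_add B x y b
      map_smul' := fun z x => ract_csmul B z x b } ‖b‖
    fun x => (norm_ract_le B x b).trans_eq (mul_comm _ _)

@[simp] theorem ractByCLM_apply (b : B) (x : Z) : ractByCLM B b x = x <• b := rfl

theorem topologicalClosure_isClosedRightSubmodule {M : Submodule ℂ Z}
    (hM : ∀ z ∈ M, ∀ b : B, z <• b ∈ M) : IsClosedRightSubmodule B M.topologicalClosure := by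
  refine ⟨M.isClosed_topologicalClosure, fun z hz b => ?_⟩
  exact map_mem_closure (ractByCLM B b).continuous hz fun a ha => hM a ha b

variable [StarOrderedRing B]

theorem norm_inn_le (x y : Z) : ‖inn B x y‖ ≤ ‖x‖ * ‖y‖ :=
  CStarModule.norm_inner_le (A := Bᵐᵒᵖ) Z

/-- The inner product as a continuous linear map in its second variable. -/
noncomputable def innCLM (x : Z) : Z →L[ℂ] B :=
  LinearMap.mkContinuous
    { toFun := fun y => inn B x y
      map_add' := inn_add_right B x
      map_smul' := fun z y => inn_csmul_right B z x y } ‖x‖ fun y => norm_inn_le B x y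

@[simp] theorem innCLM_apply (x y : Z) : innCLM B x y = inn B x y := rfl

/-- The rank one operator `z ↦ x ⟨y, z⟩`. -/
noncomputable def rankOne (x y : Z) : Z →L[ℂ] Z := ractCLM B x ∘L innCLM B y

@[simp] theorem rankOne_apply (x y z : Z) : rankOne B x y z = x <• inn B y z := rfl

theorem norm_rankOne_le (x y : Z) : ‖rankOne B x y‖ ≤ ‖x‖ * ‖y‖ := by
  refine ContinuousLinearMap.opNorm_le_bound _ (by positivity) fun z => ?_
  calc ‖x <• inn B y z‖ ≤ ‖x‖ * ‖inn B y z‖ := norm_ract_le B x _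
    _ ≤ ‖x‖ * (‖y‖ * ‖z‖) := by gcongr; exact norm_inn_le B y z
    _ = _ := by ring

theorem rankOne_ract (x y z : Z) (b : B) : rankOne B x y (z <• b) = rankOne B x y z <• b := by
  rw [rankOne_apply, rankOne_apply, inn_smul_right, ract_mul]

theorem rankOne_sub_left (x x' y z : Z) :
    rankOne B (x - x') y z = rankOne B x y z - rankOne B x' y z := by
  simp [ract_sub]

theorem inn_rankOne_left (x y z w : Z) : inn B (rankOne B x y z) w = inn B z (rankOne B y x w) := by
  rw [rankOne_apply, rankOne_apply, inn_smul_left, inn_smul_right, star_inn]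

end Basic

/-! ### Positive elements of norm one -/

section Quasiregular

variable {B : Type*} [NonUnitalCStarAlgebra B] [PartialOrder B] [StarOrderedRing B]

/-- If `b ≥ 0` has norm one, then `b ≠ c - b c`, since `1 - b` is not right invertible in the
unitization. -/
theorem ne_sub_mul_of_nonneg_of_norm_eq_one {b : B} (hb : 0 ≤ b) (h1 : ‖b‖ = 1) (c : B) :
    b ≠ c - b * c := by
  intro h
  have hsa : star b = b := (IsSelfAdjoint.of_nonneg hb).star_eq
  have hstar : b = star c - star c * b := by
    have := congrArg star h
    rwa [star_sub, star_mul, hsa] at this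
  have hcc : c = star c := by
    -- left and right quasi-inverses agree
    have e1 : star c * c = star c * b + star c * b * c := by
      have h' : c = b + b * c := by rw [eq_sub_iff_add_eq] at h; exact h.symm
      calc star c * c = star c * (b + b * c) := congrArg _ h'
        _ = _ := by rw [mul_add, mul_assoc]
    have e2 : star c * c = b * c + star c * b * c := by
      have h' : star c = b + star c * b := by rw [eq_sub_iff_add_eq] at hstar; exact hstar.symm
      calc star c * c = (b + star c * b) * c := congrArg (· * c) h'
        _ = _ := by rw [add_mul]
    have e3 : star c * b = b * c := add_right_cancel (e1.symm.trans e2)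
    have : c - b * c = star c - b * c := by rw [← h, ← e3]; exact hstar
    exact sub_left_injective this
  have hq : IsQuasiregular (-b) := by
    rw [isQuasiregular_iff]
    refine ⟨c, ?_, ?_⟩
    · rw [neg_mul, add_assoc, ← neg_add, ← sub_eq_add_neg, sub_eq_zero]
      rw [eq_sub_iff_add_eq] at h; exact h.symm
    · rw [mul_neg, add_comm (-b), add_assoc, ← neg_add, ← sub_eq_add_neg, sub_eq_zero]
      rw [eq_sub_iff_add_eq, ← hcc] at hstar; exact hstar.symm
  obtain ⟨⟨r, hr, hrn⟩, -⟩ :=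
    NonUnitalIsometricContinuousFunctionalCalculus.isGreatest_norm_quasispectrum (𝕜 := ℝ) b
      (IsSelfAdjoint.of_nonneg hb)
  have hr0 : 0 ≤ r := quasispectrum_nonneg_of_nonneg b hb r hr
  have hr1 : r = 1 := by
    simp only [Real.norm_eq_abs, abs_of_nonneg hr0, h1] at hrn
    exact hrn
  subst hr1
  have := hr isUnit_one
  simp at this
  exact this hq

end Quasiregular

/-! ### Operators bounded below -/

section BoundedBelow

variable {E : Type*} [NormedAddCommGroup E] [NormedSpace ℂ E] [CompleteSpace E]

/-- If the operators `G + t`, `t ≥ 0`, are bounded below by a common constant, then `G` is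
invertible: invertibility of `G + t` for large `t` propagates down to `t = 0` in steps of fixed
length. -/
theorem isUnit_of_forall_add_boundedBelow (G : E →L[ℂ] E) {K : ℝ} (hK : 0 < K)
    (h : ∀ t : ℝ, 0 ≤ t → ∀ x, ‖x‖ ≤ K * ‖G x + (t : ℂ) • x‖) : IsUnit G := by
  have step : ∀ t s : ℝ, 0 ≤ t → |t - s| * K < 1 → IsUnit (G + (t : ℂ) • (1 : E →L[ℂ] E)) →
      IsUnit (G + (s : ℂ) • (1 : E →L[ℂ] E)) := by
    rintro t s ht hts ⟨u, hu⟩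
    set S : E →L[ℂ] E := (↑u⁻¹ : E →L[ℂ] E) with hS
    have hSn : ‖S‖ ≤ K := by
      refine ContinuousLinearMap.opNorm_le_bound _ hK.le fun y => ?_
      have h1 : (G + (t : ℂ) • (1 : E →L[ℂ] E)) (S y) = y := by
        rw [← hu]
        exact DFunLike.congr_fun u.mul_inv y
      have h2 := h t ht (S y)
      have h3 : G (S y) + (t : ℂ) • S y = y := by simpa using h1
      rwa [h3] at h2
    have hlt : ‖((t - s : ℝ) : ℂ) • S‖ < 1 := by
      rw [norm_smul, Complex.norm_real, Real.norm_eq_abs]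
      exact (mul_le_mul_of_nonneg_left hSn (abs_nonneg _)).trans_lt hts
    have hfac : G + (s : ℂ) • (1 : E →L[ℂ] E) = u * (1 - ((t - s : ℝ) : ℂ) • S) := by
      rw [mul_sub, mul_one, mul_smul_comm, hS, u.mul_inv, hu]
      push_cast
      rw [sub_smul]
      abel
    rw [hfac]
    exact u.isUnit.mul (isUnit_one_sub_of_norm_lt_one hlt)
  set t₀ : ℝ := ‖G‖ + 1 with ht₀
  have ht₀pos : 0 < t₀ := by positivity
  have hstart : IsUnit (G + (t₀ : ℂ) • (1 : E →L[ℂ] E)) := by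
    have hne : (t₀ : ℂ) ≠ 0 := by exact_mod_cast ht₀pos.ne'
    have hlt : ‖-((t₀ : ℂ)⁻¹ • G)‖ < 1 := by
      rw [norm_neg, norm_smul, norm_inv, Complex.norm_real, Real.norm_of_nonneg ht₀pos.le,
        inv_mul_lt_iff₀ ht₀pos]
      simp [ht₀]
    have h1 := isUnit_one_sub_of_norm_lt_one hlt
    have h2 : G + (t₀ : ℂ) • (1 : E →L[ℂ] E) =
        (Units.mk0 (t₀ : ℂ) hne) • (1 - -((t₀ : ℂ)⁻¹ • G)) := by
      rw [Units.smul_def, Units.val_mk0, sub_neg_eq_add, smul_add, smul_smul,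
        mul_inv_cancel₀ hne, one_smul, add_comm]
    rw [h2]
    exact (h1.smul _)
  have hall : ∀ n : ℕ, IsUnit (G + ((max (t₀ - n * (1 / (2 * K))) 0 : ℝ) : ℂ) •
      (1 : E →L[ℂ] E)) := by
    intro n
    induction n with
    | zero => simpa [max_eq_left ht₀pos.le] using hstart
    | succ n ih =>
      refine step _ _ (le_max_right _ _) ?_ ih
      have h1 : |max (t₀ - n * (1 / (2 * K))) 0 - max (t₀ - (n + 1 : ℕ) * (1 / (2 * K))) 0| ≤
          1 / (2 * K) := by
        refine (abs_max_sub_max_le_abs _ _ _).trans ?_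
        push_cast
        rw [show t₀ - n * (1 / (2 * K)) - (t₀ - (n + 1) * (1 / (2 * K))) = 1 / (2 * K) by ring,
          abs_of_pos (by positivity)]
      calc _ ≤ 1 / (2 * K) * K := by gcongr
        _ < 1 := by field_simp; norm_num
  obtain ⟨n, hn⟩ := exists_nat_ge (t₀ * (2 * K))
  have hzero : max (t₀ - n * (1 / (2 * K))) 0 = 0 := by
    refine max_eq_right ?_
    rw [sub_nonpos, mul_one_div, le_div_iff₀ (by positivity)]
    exact hn
  have := hall n
  rw [hzero] at this
  simpa using this

end BoundedBelow

variable (B : Type*) {Z : Type*} [NonUnitalCStarAlgebra B] [PartialOrder B] [StarOrderedRing B]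
  [NormedAddCommGroup Z] [NormedSpace ℂ Z] [SMul Bᵐᵒᵖ Z] [CStarModule Bᵐᵒᵖ Z]

/-! ### Frames of finitely generated submodules -/

section Frame

theorem inn_rankOne_self_nonneg (w x : Z) : 0 ≤ inn B x (rankOne B w w x) := by
  rw [rankOne_apply, inn_smul_right, ← star_inn B w x]
  exact star_mul_self_nonneg _

/-- For generators `w i` of a complete module, `∑ i, ⟨x, w i⟩ ⟨w i, x⟩` dominates a multiple of
`‖x‖ ^ 2` in norm. This is the open mapping theorem applied to the map sending coefficients to
the element that they represent. -/
theorem exists_norm_sq_le_of_generators [CompleteSpace Z] {W : Submodule ℂ Z}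
    (hW : IsClosedRightSubmodule B W) {N : ℕ} {w : Fin N → Z} (hw : ∀ i, w i ∈ W)
    (hgen : ∀ z ∈ W, ∃ (c : Fin N → ℂ) (b : Fin N → B), z = ∑ i, (c i • w i + w i <• b i)) :
    ∃ K > 0, ∀ x ∈ W, ‖x‖ ^ 2 ≤ K * ‖inn B x (∑ i, rankOne B (w i) (w i) x)‖ := by
  have : CompleteSpace W := hW.1.completeSpace_coe
  let f₀ : ((Fin N → ℂ) × (Fin N → B)) →L[ℂ] Z := ∑ i,
    (((ContinuousLinearMap.proj (R := ℂ) (φ := fun _ : Fin N => ℂ) i).comp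
        (ContinuousLinearMap.fst ℂ (Fin N → ℂ) (Fin N → B))).smulRight (w i) +
      (ractCLM B (w i)).comp ((ContinuousLinearMap.proj (R := ℂ) (φ := fun _ : Fin N => B) i).comp
        (ContinuousLinearMap.snd ℂ (Fin N → ℂ) (Fin N → B))))
  have hf₀ : ∀ a, f₀ a = ∑ i, (a.1 i • w i + w i <• a.2 i) := fun a => by
    simp [f₀]
  have hmem : ∀ a, f₀ a ∈ W := fun a => by
    rw [hf₀]
    exact W.sum_mem fun i _ => W.add_mem (W.smul_mem _ (hw i)) (hW.2 _ (hw i) _)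
  let f : ((Fin N → ℂ) × (Fin N → B)) →L[ℂ] W := f₀.codRestrict W hmem
  have hsurj : Function.Surjective f := by
    rintro ⟨z, hz⟩
    obtain ⟨c, b, hcb⟩ := hgen z hz
    exact ⟨(c, b), Subtype.ext ((hf₀ (c, b)).trans hcb.symm)⟩
  obtain ⟨C, hC, hpre⟩ := f.exists_preimage_norm_le hsurj
  refine ⟨(2 * C * N) ^ 2 + 1, by positivity, fun x hx => ?_⟩
  obtain ⟨a, hax, hna⟩ := hpre ⟨x, hx⟩
  have hxa : x = ∑ i, (a.1 i • w i + w i <• a.2 i) := by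
    rw [← hf₀]; exact (congrArg Subtype.val hax).symm
  replace hna : ‖a‖ ≤ C * ‖x‖ := hna
  set D : ℝ := ‖inn B x (∑ i, rankOne B (w i) (w i) x)‖ with hD
  have hterm : ∀ i, ‖inn B x (w i)‖ ^ 2 ≤ D := by
    intro i
    have h1 : ‖inn B x (w i)‖ ^ 2 = ‖inn B x (rankOne B (w i) (w i) x)‖ := by
      rw [rankOne_apply, inn_smul_right, ← star_inn B x (w i), CStarRing.norm_self_mul_star, sq]
    rw [h1, hD, inn_sum_right]
    refine CStarAlgebra.norm_le_norm_of_nonneg_of_le (inn_rankOne_self_nonneg B _ _) ?_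
    exact Finset.single_le_sum (f := fun i => inn B x (rankOne B (w i) (w i) x))
      (fun j _ => inn_rankOne_self_nonneg B (w j) x) (Finset.mem_univ i)
  have hbound : ‖x‖ ^ 2 ≤ 2 * C * N * ‖x‖ * √D := by
    calc ‖x‖ ^ 2 = ‖inn B x (∑ i, (a.1 i • w i + w i <• a.2 i))‖ := by
          rw [← hxa, norm_sq_eq_norm_inn B]
      _ ≤ ∑ i, ‖inn B x (a.1 i • w i + w i <• a.2 i)‖ := by
          rw [inn_sum_right]; exact norm_sum_le _ _
      _ ≤ ∑ _i : Fin N, 2 * C * ‖x‖ * √D := by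
          refine Finset.sum_le_sum fun i _ => ?_
          have hi : ‖inn B x (w i)‖ ≤ √D := Real.le_sqrt_of_sq_le (hterm i)
          have ha1 : ‖a.1 i‖ ≤ C * ‖x‖ := ((norm_le_pi_norm _ i).trans (norm_fst_le a)).trans hna
          have ha2 : ‖a.2 i‖ ≤ C * ‖x‖ := ((norm_le_pi_norm _ i).trans (norm_snd_le a)).trans hna
          rw [inn_add_right, inn_csmul_right, inn_smul_right]
          calc _ ≤ ‖a.1 i • inn B x (w i)‖ + ‖inn B x (w i) * a.2 i‖ := norm_add_le _ _
            _ ≤ ‖a.1 i‖ * ‖inn B x (w i)‖ + ‖inn B x (w i)‖ * ‖a.2 i‖ := by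
                gcongr
                · exact (norm_smul _ _).le
                · exact norm_mul_le _ _
            _ ≤ (C * ‖x‖) * √D + √D * (C * ‖x‖) := by gcongr
            _ = _ := by ring
      _ = _ := by simp; ring
  have hle : ‖x‖ ≤ 2 * C * N * √D := by
    rcases (norm_nonneg x).eq_or_lt with h0 | h0
    · rw [← h0]; positivity
    · refine le_of_mul_le_mul_left ?_ h0
      calc ‖x‖ * ‖x‖ = ‖x‖ ^ 2 := by ring
        _ ≤ _ := hbound
        _ = _ := by ring
  have hD0 : 0 ≤ D := norm_nonneg _
  calc ‖x‖ ^ 2 ≤ (2 * C * N * √D) ^ 2 := by gcongr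
    _ = (2 * C * N) ^ 2 * D := by rw [mul_pow, Real.sq_sqrt hD0]
    _ ≤ _ := by nlinarith

/-- A closed, algebraically finitely generated submodule `W` has a finite frame: the generators
`w i`, with the dual vectors `y i = G⁻¹ (w i)`, where `G = ∑ i, w i ⟨w i, ·⟩` is invertible
on `W`. -/
theorem IsAlgFinitelyGenerated.exists_frame [CompleteSpace Z] {W : Submodule ℂ Z}
    (hW : IsClosedRightSubmodule B W) (hfg : IsAlgFinitelyGenerated B W) :
    ∃ (N : ℕ) (w y : Fin N → Z), (∀ i, w i ∈ W) ∧ (∀ i, y i ∈ W) ∧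
      ∀ x ∈ W, ∑ i, rankOne B (w i) (y i) x = x := by
  obtain ⟨N, w, hw, hgen⟩ := hfg
  have : CompleteSpace W := hW.1.completeSpace_coe
  obtain ⟨K, hK, hle⟩ := exists_norm_sq_le_of_generators B hW hw hgen
  let G₀ : Z →L[ℂ] Z := ∑ i, rankOne B (w i) (w i)
  have hG₀ : ∀ x, G₀ x = ∑ i, rankOne B (w i) (w i) x := fun x => by
    simp [G₀]
  let G : W →L[ℂ] W := (G₀ ∘L W.subtypeL).codRestrict W fun x => by
    change G₀ x ∈ W
    rw [hG₀]
    exact W.sum_mem fun i _ => hW.2 _ (hw i) _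
  have hG : ∀ x : W, (G x : Z) = ∑ i, rankOne B (w i) (w i) x := fun x => hG₀ x
  have hunit : IsUnit G := by
    refine isUnit_of_forall_add_boundedBelow G hK fun t ht x => ?_
    rcases (norm_nonneg x).eq_or_lt with h0 | h0
    · rw [← h0]; positivity
    refine le_of_mul_le_mul_left ?_ h0
    have h1 : ‖inn B (x : Z) (G x)‖ ≤ ‖inn B (x : Z) (G x + (t : ℂ) • x : W)‖ := by
      have hnn : 0 ≤ inn B (x : Z) (G x) := by
        rw [hG, inn_sum_right]
        exact Finset.sum_nonneg fun i _ => inn_rankOne_self_nonneg B _ _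
      refine CStarAlgebra.norm_le_norm_of_nonneg_of_le hnn ?_
      rw [Submodule.coe_add, Submodule.coe_smul, inn_add_right, inn_csmul_right]
      refine le_add_of_nonneg_right ?_
      rw [Complex.coe_smul]
      exact smul_nonneg ht (inn_self_nonneg B _)
    calc ‖x‖ * ‖x‖ = ‖(x : Z)‖ ^ 2 := by rw [sq]; rfl
      _ ≤ K * ‖inn B (x : Z) (G x)‖ := by rw [hG]; exact hle x x.2
      _ ≤ K * (‖(x : Z)‖ * ‖(G x + (t : ℂ) • x : W)‖) := by
          gcongr
          exact h1.trans (norm_inn_le B _ _)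
      _ = ‖x‖ * (K * ‖G x + (t : ℂ) • x‖) := by
          rw [Submodule.coe_norm, Submodule.coe_norm]; ring
  obtain ⟨U, hU⟩ := hunit
  let S : W →L[ℂ] W := (↑U⁻¹ : W →L[ℂ] W)
  have hGS : ∀ x, G (S x) = x := fun x => by
    rw [← hU]; exact DFunLike.congr_fun U.mul_inv x
  have hGsymm : ∀ a b : W, inn B (G a : Z) b = inn B (a : Z) (G b) := fun a b => by
    rw [hG, hG, inn_sum_left, inn_sum_right]
    exact Finset.sum_congr rfl fun i _ => inn_rankOne_left B _ _ _ _
  have hSsymm : ∀ a b : W, inn B (S a : Z) b = inn B (a : Z) (S b) := fun a b => by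
    conv_lhs => rw [← hGS b]
    rw [← hGsymm, hGS]
  refine ⟨N, w, fun i => S ⟨w i, hw i⟩, hw, fun i => (S _).2, fun x hx => ?_⟩
  calc ∑ i, rankOne B (w i) (S ⟨w i, hw i⟩ : Z) x
      = ∑ i, rankOne B (w i) (w i) (S ⟨x, hx⟩ : Z) := by
        refine Finset.sum_congr rfl fun i _ => ?_
        rw [rankOne_apply, rankOne_apply]
        congr 2
        exact hSsymm ⟨w i, hw i⟩ ⟨x, hx⟩
    _ = x := by rw [← hG, hGS]

/-- The adjoint of the frame operator projects onto `W` along its orthogonal complement. -/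
theorem exists_mem_forall_inn_sub_eq_zero {W : Submodule ℂ Z}
    (hW : ∀ z ∈ W, ∀ b : B, z <• b ∈ W) {N : ℕ} {w y : Fin N → Z} (hy : ∀ i, y i ∈ W)
    (hframe : ∀ x ∈ W, ∑ i, rankOne B (w i) (y i) x = x) (x : Z) :
    ∃ a ∈ W, ∀ z ∈ W, inn B z (x - a) = 0 := by
  refine ⟨∑ i, rankOne B (y i) (w i) x, W.sum_mem fun i _ => hW _ (hy i) _, fun z hz => ?_⟩
  rw [inn_sub_right, sub_eq_zero]
  conv_lhs => rw [← hframe z hz]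
  rw [inn_sum_left, inn_sum_right]
  exact Finset.sum_congr rfl fun i _ => inn_rankOne_left B _ _ _ _

end Frame

/-! ### Existence of maximal submodules -/

section Maximal

variable [CompleteSpace Z]

/-- If the identity is a finite rank operator modulo operators into `M`, and the closure of `M`
contains the vectors `z i` of that operator, then `M` is everything: after replacing `z i` by
elements of `M` close to them, the error is an operator of norm less than one. -/
theorem eq_top_of_mem_closure {M : Submodule ℂ Z} (hM : ∀ z ∈ M, ∀ b : B, z <• b ∈ M)
    {N : ℕ} {z y : Fin N → Z} (hR : ∀ x, x - ∑ i, rankOne B (z i) (y i) x ∈ M)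
    (hz : ∀ i, z i ∈ closure (M : Set Z)) : M = ⊤ := by
  have hpos : 0 < ∑ i, ‖y i‖ + 1 := by positivity
  have hex : ∀ i, ∃ m ∈ M, ‖z i - m‖ < (∑ i, ‖y i‖ + 1)⁻¹ := fun i => by
    obtain ⟨m, hm, hd⟩ := Metric.mem_closure_iff.mp (hz i) _ (inv_pos.mpr hpos)
    exact ⟨m, hm, by rwa [dist_eq_norm] at hd⟩
  choose m hm hd using hex
  let S : Z →L[ℂ] Z := ∑ i, rankOne B (z i - m i) (y i)
  have hS : ‖S‖ < 1 := by
    calc ‖S‖ ≤ ∑ i, ‖z i - m i‖ * ‖y i‖ :=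
          norm_sum_le_of_le _ fun i _ => norm_rankOne_le B _ _
      _ ≤ ∑ i, (∑ i, ‖y i‖ + 1)⁻¹ * ‖y i‖ := by
          gcongr with i; exact (hd i).le
      _ = (∑ i, ‖y i‖ + 1)⁻¹ * ∑ i, ‖y i‖ := by rw [Finset.mul_sum]
      _ < 1 := by rw [inv_mul_lt_iff₀ hpos]; simp
  obtain ⟨U, hU⟩ := isUnit_one_sub_of_norm_lt_one hS
  rw [eq_top_iff]
  intro x _
  have hx : (1 - S) ((↑U⁻¹ : Z →L[ℂ] Z) x) = x := by
    rw [← hU]; exact DFunLike.congr_fun U.mul_inv x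
  rw [← hx]
  set t := (↑U⁻¹ : Z →L[ℂ] Z) x
  have hst : (1 - S) t = (t - ∑ i, rankOne B (z i) (y i) t) + ∑ i, rankOne B (m i) (y i) t := by
    simp only [S, sub_apply, one_apply_eq_self, sum_apply, rankOne_sub_left, Finset.sum_sub_distrib]
    abel
  rw [hst]
  exact M.add_mem (hR t) (M.sum_mem fun i _ => hM _ (hm i) _)

theorem topologicalClosure_ne_top {M : Submodule ℂ Z} (hM : ∀ z ∈ M, ∀ b : B, z <• b ∈ M)
    (hne : M ≠ ⊤) {N : ℕ} {z y : Fin N → Z} (hR : ∀ x, x - ∑ i, rankOne B (z i) (y i) x ∈ M) :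
    M.topologicalClosure ≠ ⊤ := fun h =>
  hne <| eq_top_of_mem_closure B hM hR fun i => by
    rw [← M.topologicalClosure_coe, h]; trivial

/-- A proper right submodule, modulo which the identity is a finite rank operator, is contained in
a maximal right submodule. -/
theorem exists_isMaximalRightSubmodule_ge {M : Submodule ℂ Z}
    (hM : ∀ z ∈ M, ∀ b : B, z <• b ∈ M) (hne : M ≠ ⊤) {N : ℕ} {z y : Fin N → Z}
    (hR : ∀ x, x - ∑ i, rankOne B (z i) (y i) x ∈ M) :
    ∃ W, IsMaximalRightSubmodule B W ∧ M ≤ W := by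
  let 𝒮 : Set (Submodule ℂ Z) := {V | (∀ z ∈ V, ∀ b : B, z <• b ∈ V) ∧ V ≠ ⊤ ∧ M ≤ V}
  obtain ⟨W, hMW, hWmax⟩ := zorn_le_nonempty₀ 𝒮 (fun c hc hchain V₀ hV₀ => by
    have hdir : DirectedOn (· ≤ ·) c := hchain.directedOn
    have hcne : c.Nonempty := ⟨V₀, hV₀⟩
    refine ⟨sSup c, ⟨fun x hx b => ?_, fun htop => ?_, ?_⟩, fun V hV => le_sSup hV⟩
    · obtain ⟨V, hV, hxV⟩ := (Submodule.mem_sSup_of_directed hcne hdir).mp hx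
      exact Submodule.mem_sSup_of_mem hV ((hc hV).1 x hxV b)
    · -- finitely many vectors lie in one member of the chain
      have hmem : ∀ i, ∃ V ∈ c, z i ∈ V := fun i =>
        (Submodule.mem_sSup_of_directed hcne hdir).mp (htop ▸ Submodule.mem_top)
      choose V hV hzV using hmem
      obtain ⟨V', hV', hle⟩ : ∃ V' ∈ c, ∀ i, V i ≤ V' := by
        have : Nonempty c := hcne.to_subtype
        obtain ⟨V', h⟩ := hdir.directed_val.finite_le fun i => (⟨V i, hV i⟩ : c)
        exact ⟨V', V'.2, h⟩
      exact (hc hV').2.1 <| eq_top_of_mem_closure B (hc hV').1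
        (fun x => (hc hV').2.2 (hR x)) fun i => subset_closure (hle i (hzV i))
    · exact (hc hV₀).2.2.trans (le_sSup hV₀)) M ⟨hM, hne, le_rfl⟩
  have hW := hWmax.prop
  have hRW : ∀ x, x - ∑ i, rankOne B (z i) (y i) x ∈ W := fun x => hMW (hR x)
  have hcl : W.topologicalClosure = W := by
    refine (hWmax.eq_of_ge ⟨(topologicalClosure_isClosedRightSubmodule B hW.1).2,
      topologicalClosure_ne_top B hW.1 hW.2.1 hRW, ?_⟩ W.le_topologicalClosure)
    exact hMW.trans W.le_topologicalClosure
  refine ⟨W, ⟨⟨⟨?_, hW.1⟩, hW.2.1⟩, fun V hV hWV => ?_⟩, hMW⟩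
  · rw [← hcl]; exact W.isClosed_topologicalClosure
  · exact hWmax.2 ⟨hV.1.2, hV.2, hMW.trans hWV⟩ hWV

end Maximal

end RightHilbert

namespace RightHilbert

variable (B : Type*) {Z : Type*} [NonUnitalCStarAlgebra B] [PartialOrder B] [StarOrderedRing B]
  [NormedAddCommGroup Z] [NormedSpace ℂ Z] [SMul Bᵐᵒᵖ Z] [CStarModule Bᵐᵒᵖ Z]

/-! ### Minimal vectors -/

section MinimalVector

/-- The submodule of the vectors fixed by `e ⟨e, ·⟩`. -/
def fixedSpace (e : Z) : Submodule ℂ Z where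
  carrier := {x | rankOne B e e x = x}
  add_mem' hx hy := by simp only [Set.mem_ofPred_eq, map_add] at *; rw [hx, hy]
  zero_mem' := map_zero _
  smul_mem' c x hx := by simp only [Set.mem_ofPred_eq, map_smul] at *; rw [hx]

variable {B}

theorem mem_fixedSpace {e x : Z} : x ∈ fixedSpace B e ↔ e <• inn B e x = x := Iff.rfl

theorem isClosedRightSubmodule_fixedSpace (e : Z) :
    IsClosedRightSubmodule B (fixedSpace B e) := by
  refine ⟨isClosed_eq (rankOne B e e).continuous continuous_id, fun z hz b => ?_⟩
  change rankOne B e e (z <• b) = z <• b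
  rw [rankOne_ract]
  exact congrArg (· <• b) hz

variable (B) in
/-- A minimal vector: a nonzero `e` such that `e ⟨e, ·⟩` is a projection, onto a submodule on which
`v ⟨v, ·⟩` is the scalar `‖v‖ ^ 2` for all of its elements `v`. -/
def IsMinimalVector (e : Z) : Prop :=
  e ≠ 0 ∧ e ∈ fixedSpace B e ∧
    ∀ v ∈ fixedSpace B e, ∀ x ∈ fixedSpace B e, v <• inn B v x = ((‖v‖ ^ 2 : ℝ) : ℂ) • x

namespace IsMinimalVector

variable {e : Z}

/-- On the submodule of a minimal vector, rank one operators are scalars, by polarization. -/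
theorem exists_smul (he : IsMinimalVector B e) {u v : Z} (hu : u ∈ fixedSpace B e)
    (hv : v ∈ fixedSpace B e) : ∃ c : ℂ, ∀ x ∈ fixedSpace B e, u <• inn B v x = c • x := by
  let Q : Z → ℂ := fun v => ((‖v‖ ^ 2 : ℝ) : ℂ)
  refine ⟨(1 / 2 : ℂ) * ((Q (u + v) - Q u - Q v) +
    Complex.I * (Q (u + Complex.I • v) - Q u - Q v)), fun x hx => ?_⟩
  have h1 := he.2.2 _ (Submodule.add_mem _ hu hv) x hx
  have h2 := he.2.2 _ (Submodule.add_mem _ hu (Submodule.smul_mem _ Complex.I hv)) x hx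
  have hu' := he.2.2 u hu x hx
  have hv' := he.2.2 v hv x hx
  change _ = Q _ • x at h1 h2 hu' hv'
  rw [mul_smul, add_smul, mul_smul, sub_smul, sub_smul, sub_smul, sub_smul, ← h1, ← h2, ← hu',
    ← hv']
  simp only [inn_add_left, inn_csmul_left, ract_add, ract_add_right, ract_csmul, ract_csmul_right]
  simp only [smul_sub, smul_add, smul_smul, Complex.star_def, Complex.conj_I, mul_neg,
    Complex.I_mul_I, neg_neg]
  generalize u <• inn B v x = p, v <• inn B u x = q, u <• inn B u x = r, v <• inn B v x = s
  module

theorem eq_of_smul_eq (he : IsMinimalVector B e) {c d : ℂ} (h : c • e = d • e) : c = d :=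
  smul_left_injective ℂ he.1 h

theorem inn_mul_inn (he : IsMinimalVector B e) : inn B e e * inn B e e = inn B e e := by
  rw [← inn_smul_right, mem_fixedSpace.mp he.2.1]

theorem exists_inn_mul_mul_inn (he : IsMinimalVector B e) (b : B) :
    ∃ c : ℂ, inn B e e * b * inn B e e = c • inn B e e := by
  obtain ⟨c, hc⟩ := he.exists_smul ((isClosedRightSubmodule_fixedSpace e).2 e he.2.1 b) he.2.1
  refine ⟨c, ?_⟩
  rw [← inn_csmul_right, ← hc e he.2.1, inn_smul_right, inn_smul_right]

end IsMinimalVector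

end MinimalVector

/-! ### Complements of maximal submodules -/

section Maximal

/-- A unit vector `v` is not in the range of `1 - v ⟨v, ·⟩`. -/
theorem ne_sub_rankOne_of_norm_eq_one {v : Z} (hv : ‖v‖ = 1) (y : Z) :
    v ≠ y - rankOne B v v y := by
  intro h
  have h1 := congrArg (inn B v) h
  rw [rankOne_apply, inn_sub_right, inn_smul_right] at h1
  exact ne_sub_mul_of_nonneg_of_norm_eq_one (inn_self_nonneg B v)
    (by rw [← norm_sq_eq_norm_inn, hv, one_pow]) _ h1

/-- The range of `1 - v ⟨v, ·⟩`. -/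
noncomputable def coRange (v : Z) : Submodule ℂ Z :=
  LinearMap.range ((1 : Z →L[ℂ] Z) - rankOne B v v).toLinearMap

theorem mem_coRange {v x : Z} : x ∈ coRange B v ↔ ∃ y, y - rankOne B v v y = x := Iff.rfl

theorem ract_mem_coRange (v : Z) : ∀ z ∈ coRange B v, ∀ b : B, z <• b ∈ coRange B v := by
  rintro _ ⟨y, rfl⟩ b
  rw [mem_coRange]
  exact ⟨y <• b, by rw [rankOne_ract, ← ract_sub]; rfl⟩

theorem coRange_ne_top {v : Z} (hv : ‖v‖ = 1) : coRange B v ≠ ⊤ := fun h => by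
  obtain ⟨y, hy⟩ := (mem_coRange B).mp (h ▸ Submodule.mem_top : v ∈ coRange B v)
  exact ne_sub_rankOne_of_norm_eq_one B hv y hy.symm

theorem sub_sum_rankOne_mem_coRange (v x : Z) :
    x - ∑ i, rankOne B ((fun _ : Fin 1 => v) i) ((fun _ => v) i) x ∈ coRange B v := by
  rw [Fin.sum_univ_one]
  exact (mem_coRange B).mpr ⟨x, rfl⟩

variable [CompleteSpace Z]

theorem exists_isMaximalRightSubmodule [Nontrivial Z] :
    ∃ W : Submodule ℂ Z, IsMaximalRightSubmodule B W := by
  obtain ⟨x, hx⟩ := exists_ne (0 : Z)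
  have hv : ‖((‖x‖ : ℂ)⁻¹ • x)‖ = 1 := norm_smul_inv_norm hx
  obtain ⟨W, hW, -⟩ := exists_isMaximalRightSubmodule_ge B (ract_mem_coRange B _)
    (coRange_ne_top B hv) (sub_sum_rankOne_mem_coRange B _)
  exact ⟨W, hW⟩

namespace IsMaximalRightSubmodule

variable {B} {W : Submodule ℂ Z}

/-- If the unit vector `v` is orthogonal to the maximal submodule `W`, then `1 - v ⟨v, ·⟩` maps
into `W`: the closure of its range is proper and contains `W`. -/
theorem sub_rankOne_mem (hW : IsMaximalRightSubmodule B W) {v : Z} (hv : ‖v‖ = 1)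
    (horth : ∀ w ∈ W, inn B v w = 0) (x : Z) : x - rankOne B v v x ∈ W := by
  have hle : W ≤ coRange B v := fun w hw => by
    rw [mem_coRange]
    exact ⟨w, by rw [rankOne_apply, horth w hw, ract_zero, sub_zero]⟩
  have hcl : W = (coRange B v).topologicalClosure :=
    hW.eq_of_le ⟨topologicalClosure_isClosedRightSubmodule B (ract_mem_coRange B v),
      topologicalClosure_ne_top B (ract_mem_coRange B v) (coRange_ne_top B hv)
        (sub_sum_rankOne_mem_coRange B v)⟩ (hle.trans (Submodule.le_topologicalClosure _))
  rw [hcl]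
  exact Submodule.le_topologicalClosure _ ((mem_coRange B).mpr ⟨x, rfl⟩)

/-- On the orthogonal complement of `W`, the operator `v ⟨v, ·⟩` is the scalar `‖v‖ ^ 2`: for unit
vectors `v` the difference of `x` and `v ⟨v, x⟩` lies both in `W` and in its complement. -/
theorem smul_inn_eq (hW : IsMaximalRightSubmodule B W) {v x : Z}
    (hv : ∀ w ∈ W, inn B v w = 0) (hx : ∀ w ∈ W, inn B x w = 0) :
    v <• inn B v x = ((‖v‖ ^ 2 : ℝ) : ℂ) • x := by
  rcases eq_or_ne v 0 with rfl | hv0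
  · simp [zero_ract]
  have hn : ‖v‖ ≠ 0 := norm_ne_zero_iff.mpr hv0
  set u : Z := (‖v‖ : ℂ)⁻¹ • v with hu
  have hu1 : ‖u‖ = 1 := norm_smul_inv_norm hv0
  have huW : ∀ w ∈ W, inn B u w = 0 := fun w hw => by
    rw [hu, inn_csmul_left, hv w hw, smul_zero]
  have hmem := hW.sub_rankOne_mem hu1 huW x
  have hz : x - rankOne B u u x = 0 := by
    have key : ∀ t ∈ W, inn B (x - rankOne B u u x) t = 0 := fun t ht => by
      rw [inn_sub_left, hx t ht, rankOne_apply, inn_smul_left, huW t ht, mul_zero, sub_zero]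
    exact inn_self_eq_zero.mp (key _ hmem)
  have hvu : v = (‖v‖ : ℂ) • u := by
    rw [hu, smul_smul, mul_inv_cancel₀ (Complex.ofReal_ne_zero.mpr hn), one_smul]
  have hux : u <• inn B u x = x := (sub_eq_zero.mp hz).symm
  calc v <• inn B v x = ((‖v‖ : ℂ) • u) <• inn B ((‖v‖ : ℂ) • u) x := by rw [← hvu]
    _ = ((‖v‖ ^ 2 : ℝ) : ℂ) • x := by
      rw [inn_csmul_left, ract_csmul, ract_csmul_right, hux, smul_smul, Complex.star_def,
        Complex.conj_ofReal, sq, Complex.ofReal_mul]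

theorem isMinimalVector (hW : IsMaximalRightSubmodule B W) {v : Z} (hv : ‖v‖ = 1)
    (horth : ∀ w ∈ W, inn B v w = 0) : IsMinimalVector B v := by
  have hle : ∀ x ∈ fixedSpace B v, ∀ w ∈ W, inn B x w = 0 := fun x hx w hw => by
    rw [← mem_fixedSpace.mp hx, inn_smul_left, horth w hw, mul_zero]
  refine ⟨norm_ne_zero_iff.mp (hv ▸ one_ne_zero), ?_, fun u hu x hx =>
    hW.smul_inn_eq (hle u hu) (hle x hx)⟩
  rw [mem_fixedSpace, hW.smul_inn_eq horth horth, hv]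
  simp

theorem exists_norm_eq_one_orthogonal (hW : IsMaximalRightSubmodule B W)
    (hfg : IsAlgFinitelyGenerated B W) : ∃ v : Z, ‖v‖ = 1 ∧ ∀ w ∈ W, inn B v w = 0 := by
  obtain ⟨N, w, y, -, hy, hframe⟩ := hfg.exists_frame B hW.prop.1
  obtain ⟨x, -, hx⟩ := SetLike.exists_of_lt (lt_top_iff_ne_top.mpr hW.prop.2)
  obtain ⟨a, ha, horth⟩ := exists_mem_forall_inn_sub_eq_zero B hW.prop.1.2 hy hframe x
  have hne : x - a ≠ 0 := fun h => hx (by rwa [sub_eq_zero.mp h])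
  refine ⟨(‖x - a‖ : ℂ)⁻¹ • (x - a), norm_smul_inv_norm hne, fun w hw => ?_⟩
  rw [inn_csmul_left, inn_eq_zero_comm.mp (horth w hw), smul_zero]

/-- If one maximal submodule is finitely generated, then the whole module has a finite frame. -/
theorem exists_frame (hW : IsMaximalRightSubmodule B W) (hfg : IsAlgFinitelyGenerated B W) :
    ∃ (N : ℕ) (z y : Fin N → Z), ∀ x, ∑ i, rankOne B (z i) (y i) x = x := by
  obtain ⟨v, hv, horth⟩ := hW.exists_norm_eq_one_orthogonal hfg
  obtain ⟨N, w, y, -, hy, hframe⟩ := hfg.exists_frame B hW.prop.1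
  refine ⟨N + 1, Fin.cons v w, Fin.cons v y, fun x => ?_⟩
  have h1 := hframe _ (hW.sub_rankOne_mem hv horth x)
  have h2 : ∀ i, rankOne B (w i) (y i) (x - rankOne B v v x) = rankOne B (w i) (y i) x :=
    fun i => by
      rw [rankOne_apply, rankOne_apply, inn_sub_right, rankOne_apply, inn_smul_right,
        inn_eq_zero_comm.mp (horth _ (hy i)), zero_mul, sub_zero]
  rw [Fin.sum_univ_succ]
  simp only [Fin.cons_zero, Fin.cons_succ, ← h2, h1]
  abel

end IsMaximalRightSubmodule

end Maximal

/-! ### Orthogonal systems of minimal vectors -/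

section System

variable {B}

variable (B) in
/-- Orthogonal systems of minimal vectors `e` whose projections `⟨e, e⟩` are pairwise equal or
centrally orthogonal. -/
structure IsMinimalSystem (E : Set Z) : Prop where
  isMinimalVector : ∀ e ∈ E, IsMinimalVector B e
  inn_eq_zero : ∀ e ∈ E, ∀ f ∈ E, e ≠ f → inn B e f = 0
  eq_or_forall_mul_eq_zero : ∀ e ∈ E, ∀ f ∈ E,
    inn B e e = inn B f f ∨ ∀ b, inn B e e * b * inn B f f = 0

/-- A finite part of an orthogonal system recovers `x` if a smaller part does. -/
theorem IsMinimalSystem.sum_rankOne_of_subset {E : Set Z} (hE : IsMinimalSystem B E)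
    {F F' : Finset Z} (hFF' : F ⊆ F') (hF' : (F' : Set Z) ⊆ E) {x : Z}
    (hx : ∑ e ∈ F, rankOne B e e x = x) : ∑ e ∈ F', rankOne B e e x = x := by
  rw [← Finset.sum_subset hFF', hx]
  intro e he heF
  rw [rankOne_apply, ← hx, inn_sum_right, Finset.sum_eq_zero, ract_zero]
  intro f hf
  rw [rankOne_apply, inn_smul_right, hE.inn_eq_zero e (hF' he) f (hF' (hFF' hf))
    (fun h => heF (h ▸ hf)), zero_mul]

/-- The right submodule of the vectors recovered by a finite part of an orthogonal system. -/
def IsMinimalSystem.span {E : Set Z} (hE : IsMinimalSystem B E) : Submodule ℂ Z where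
  carrier := {x | ∃ F : Finset Z, (F : Set Z) ⊆ E ∧ ∑ e ∈ F, rankOne B e e x = x}
  add_mem' := by
    classical
    rintro x y ⟨F, hF, hx⟩ ⟨F', hF', hy⟩
    have hU : ((F ∪ F' : Finset Z) : Set Z) ⊆ E := by
      rw [Finset.coe_union]; exact Set.union_subset hF hF'
    refine ⟨F ∪ F', hU, ?_⟩
    simp only [map_add, Finset.sum_add_distrib]
    rw [hE.sum_rankOne_of_subset Finset.subset_union_left hU hx,
      hE.sum_rankOne_of_subset Finset.subset_union_right hU hy]
  zero_mem' := ⟨∅, by simp, by simp⟩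
  smul_mem' := by
    rintro c x ⟨F, hF, hx⟩
    refine ⟨F, hF, ?_⟩
    simp only [map_smul, ← Finset.smul_sum, hx]

theorem IsMinimalSystem.mem_span {E : Set Z} (hE : IsMinimalSystem B E) {x : Z} :
    x ∈ hE.span ↔ ∃ F : Finset Z, (F : Set Z) ⊆ E ∧ ∑ e ∈ F, rankOne B e e x = x := Iff.rfl

theorem IsMinimalSystem.ract_mem_span {E : Set Z} (hE : IsMinimalSystem B E) :
    ∀ z ∈ hE.span, ∀ b : B, z <• b ∈ hE.span := by
  rintro z ⟨F, hF, hz⟩ b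
  refine ⟨F, hF, ?_⟩
  simp only [rankOne_ract, ← sum_ract, hz]

theorem IsMinimalSystem.subset_span {E : Set Z} (hE : IsMinimalSystem B E) {e : Z} (he : e ∈ E) :
    e ∈ hE.span :=
  ⟨{e}, by simpa using he, by rw [Finset.sum_singleton]; exact (hE.isMinimalVector e he).2.1⟩

theorem exists_maximal_isMinimalSystem :
    ∃ E : Set Z, Maximal (IsMinimalSystem B) E := by
  refine zorn_subset {E : Set Z | IsMinimalSystem B E} fun c hc hchain => ?_
  have hpair : ∀ e ∈ ⋃₀ c, ∀ f ∈ ⋃₀ c, ∃ E ∈ c, e ∈ E ∧ f ∈ E := by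
    rintro e ⟨E, hE, he⟩ f ⟨F, hF, hf⟩
    rcases hchain.total hE hF with h | h
    · exact ⟨F, hF, h he, hf⟩
    · exact ⟨E, hE, he, h hf⟩
  refine ⟨⋃₀ c, ⟨?_, ?_, ?_⟩, fun E hE => Set.subset_sUnion_of_mem hE⟩
  · rintro e ⟨E, hE, he⟩
    exact (hc hE).isMinimalVector e he
  · intro e he f hf
    obtain ⟨E, hE, he, hf⟩ := hpair e he f hf
    exact (hc hE).inn_eq_zero e he f hf
  · intro e he f hf
    obtain ⟨E, hE, he, hf⟩ := hpair e he f hf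
    exact (hc hE).eq_or_forall_mul_eq_zero e he f hf

theorem IsMinimalSystem.insert_vector {E : Set Z} (hE : IsMinimalSystem B E) {v : Z}
    (hv : IsMinimalVector B v) (horth : ∀ e ∈ E, inn B v e = 0)
    (hrel : ∀ e ∈ E, inn B v v = inn B e e ∨ ∀ b, inn B v v * b * inn B e e = 0) :
    IsMinimalSystem B (insert v E) := by
  refine ⟨?_, ?_, ?_⟩
  · rintro e (rfl | he)
    · exact hv
    · exact hE.isMinimalVector e he
  · rintro e (rfl | he) f (rfl | hf) hne
    · exact absurd rfl hne
    · exact horth f hf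
    · exact inn_eq_zero_comm.mp (horth e he)
    · exact hE.inn_eq_zero e he f hf hne
  · rintro e (rfl | he) f (rfl | hf)
    · exact Or.inl rfl
    · exact hrel f hf
    · refine (hrel e he).imp Eq.symm fun h b => ?_
      rw [← star_eq_zero]
      simpa [star_inn, mul_assoc] using h (star b)
    · exact hE.eq_or_forall_mul_eq_zero e he f hf

/-- Let `v` be a unit vector orthogonal to the maximal submodule `W`, and let the system `E`
consist of vectors of `W`. The system can be enlarged by a unit vector orthogonal to `W`: by `v`
itself if its projection is centrally orthogonal to those of `E`, and otherwise by a multiple of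
some nonzero `v b ⟨e, e⟩`, which has the same projection as `e`. -/
theorem IsMinimalSystem.exists_insert [CompleteSpace Z] {E : Set Z} (hE : IsMinimalSystem B E)
    {W : Submodule ℂ Z} (hW : IsMaximalRightSubmodule B W) (hEW : E ⊆ W) {v : Z} (hv : ‖v‖ = 1)
    (horth : ∀ w ∈ W, inn B v w = 0) :
    ∃ u, ‖u‖ = 1 ∧ (∀ w ∈ W, inn B u w = 0) ∧ IsMinimalSystem B (insert u E) := by
  by_cases h : ∀ e ∈ E, ∀ b, inn B v v * b * inn B e e = 0
  · exact ⟨v, hv, horth, hE.insert_vector (hW.isMinimalVector hv horth) (fun e he => horth e (hEW he))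
      fun e he => Or.inr (h e he)⟩
  push Not at h
  obtain ⟨e, he, b, hb⟩ := h
  have hemin := hE.isMinimalVector e he
  set u₀ : Z := v <• b <• inn B e e with hu₀
  have hu₀ne : u₀ ≠ 0 := fun h0 => hb <| by
    rw [← inn_smul_right, ← inn_smul_right, ← hu₀, h0, inn_zero_right]
  set u : Z := (‖u₀‖ : ℂ)⁻¹ • u₀ with hu
  have hu1 : ‖u‖ = 1 := norm_smul_inv_norm hu₀ne
  have huW : ∀ w ∈ W, inn B u w = 0 := fun w hw => by
    rw [hu, hu₀, inn_csmul_left, inn_smul_left, inn_smul_left, horth w hw]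
    simp
  have humin := hW.isMinimalVector hu1 huW
  have hup : u <• inn B e e = u := by
    rw [hu, hu₀, ract_csmul, ← ract_mul B (v <• b), hemin.inn_mul_inn]
  have huu : inn B u u = inn B e e := by
    obtain ⟨c, hc⟩ := hemin.exists_inn_mul_mul_inn (inn B u u)
    have h1 : inn B u u = c • inn B e e := by
      conv_lhs => rw [← hup]
      rw [inn_smul_left, inn_smul_right, star_inn, ← mul_assoc, hc]
    have h2 : (1 : ℂ) • u = c • u := by
      calc (1 : ℂ) • u = u <• inn B u u := by rw [one_smul]; exact humin.2.1.symm
        _ = c • u := by rw [h1, ract_csmul_right, hup]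
    rw [h1, ← humin.eq_of_smul_eq h2, one_smul]
  refine ⟨u, hu1, huW, hE.insert_vector humin (fun f hf => huW f (hEW hf)) fun f hf => ?_⟩
  rw [huu]
  exact hE.eq_or_forall_mul_eq_zero e he f hf

/-- If all maximal submodules are finitely generated, then the module is the finite orthogonal sum
of the minimal submodules `e B`, for the vectors `e` of a system. -/
theorem exists_isMinimalSystem_sum_rankOne_eq [CompleteSpace Z]
    (h : ∀ W : Submodule ℂ Z, IsMaximalRightSubmodule B W → IsAlgFinitelyGenerated B W) :
    ∃ F : Finset Z, IsMinimalSystem B (F : Set Z) ∧ ∀ x, ∑ e ∈ F, rankOne B e e x = x := by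
  classical
  rcases subsingleton_or_nontrivial Z with hZ | hZ
  · exact ⟨∅, ⟨by simp, by simp, by simp⟩, fun x => Subsingleton.elim _ _⟩
  obtain ⟨W₀, hW₀⟩ := exists_isMaximalRightSubmodule B (Z := Z)
  obtain ⟨N, z, y, hframe⟩ := hW₀.exists_frame (h W₀ hW₀)
  obtain ⟨E, hE⟩ := exists_maximal_isMinimalSystem (B := B) (Z := Z)
  have htop : hE.prop.span = ⊤ := by
    by_contra hne
    obtain ⟨W, hW, hle⟩ := exists_isMaximalRightSubmodule_ge B hE.prop.ract_mem_span hne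
      (z := z) (y := y) fun x => by rw [hframe, sub_self]; exact Submodule.zero_mem _
    obtain ⟨v, hv, horth⟩ := hW.exists_norm_eq_one_orthogonal (h W hW)
    have hEW : E ⊆ W := fun e he => hle (hE.prop.subset_span he)
    obtain ⟨u, hu1, huW, hu⟩ := hE.prop.exists_insert hW hEW hv horth
    have huE : u ∈ E := by
      rw [hE.eq_of_subset hu (Set.subset_insert u E)]
      exact Set.mem_insert u E
    have : u = 0 := inn_self_eq_zero.mp (huW u (hEW huE))
    rw [this, norm_zero] at hu1
    exact zero_ne_one hu1
  have hfin : ∀ i, ∃ F : Finset Z, (F : Set Z) ⊆ E ∧ ∑ e ∈ F, rankOne B e e (z i) = z i :=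
    fun i => hE.prop.mem_span.mp (htop ▸ Submodule.mem_top)
  choose F hFE hF using hfin
  set F' : Finset Z := Finset.univ.biUnion F
  have hF'E : (F' : Set Z) ⊆ E := by
    intro e he
    obtain ⟨i, -, hi⟩ := Finset.mem_biUnion.mp he
    exact hFE i hi
  refine ⟨F', ⟨fun e he => hE.prop.isMinimalVector e (hF'E he),
    fun e he f hf => hE.prop.inn_eq_zero e (hF'E he) f (hF'E hf),
    fun e he f hf => hE.prop.eq_or_forall_mul_eq_zero e (hF'E he) f (hF'E hf)⟩, fun x => ?_⟩
  have hz : ∀ i, ∑ e ∈ F', rankOne B e e (z i) = z i := fun i =>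
    hE.prop.sum_rankOne_of_subset (Finset.subset_biUnion_of_mem F (Finset.mem_univ i)) hF'E (hF i)
  calc ∑ e ∈ F', rankOne B e e x
      = ∑ e ∈ F', rankOne B e e (∑ i, rankOne B (z i) (y i) x) := by rw [hframe]
    _ = ∑ i, rankOne B (z i) (y i) x := by
        simp only [map_sum]
        rw [Finset.sum_comm]
        refine Finset.sum_congr rfl fun i _ => ?_
        simp only [rankOne_apply B (z i), rankOne_ract, ← sum_ract, hz]
    _ = x := hframe x

end System

end RightHilbert

namespace RightHilbert

/-! ### Operators into a finite dimensional Hilbert space, by rows -/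

section RowOperators

open scoped InnerProductSpace

variable {H : Type*} [NormedAddCommGroup H] [InnerProductSpace ℂ H] {n : ℕ}

/-- The operator `H → ℂ ^ n` whose rows are the functionals `⟪x i, ·⟫`. -/
noncomputable def rowOp (x : Fin n → H) : H →L[ℂ] EuclideanSpace ℂ (Fin n) :=
  (EuclideanSpace.equiv (Fin n) ℂ).symm.toContinuousLinearMap ∘L
    ContinuousLinearMap.pi fun i => innerSL ℂ (x i)

@[simp] theorem rowOp_apply (x : Fin n → H) (ξ : H) (i : Fin n) : rowOp x ξ i = ⟪x i, ξ⟫_ℂ := rfl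

theorem rowOp_injective : Function.Injective (rowOp : (Fin n → H) → _) := fun _ _ h =>
  funext fun i => ext_inner_right ℂ fun ξ => congrArg (fun A => A ξ i) h

variable [CompleteSpace H]

theorem rowOp_surjective : Function.Surjective (rowOp : (Fin n → H) → _) := fun A =>
  ⟨fun i => (InnerProductSpace.toDual ℂ H).symm (EuclideanSpace.proj i ∘L A), by
    ext ξ i; simp⟩

theorem adjoint_rowOp (y : Fin n → H) (η : EuclideanSpace ℂ (Fin n)) :
    ContinuousLinearMap.adjoint (rowOp y) η = ∑ j, η j • y j := by
  refine ext_inner_right ℂ fun ξ => ?_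
  rw [ContinuousLinearMap.adjoint_inner_left, sum_inner, PiLp.inner_apply]
  refine Finset.sum_congr rfl fun j _ => ?_
  rw [inner_smul_left, rowOp_apply, RCLike.inner_apply, mul_comm]

theorem rowOp_triple (x y z : Fin n → H) :
    rowOp x ∘L ContinuousLinearMap.adjoint (rowOp y) ∘L rowOp z =
      rowOp fun i => ∑ j, ⟪y j, x i⟫_ℂ • z j := by
  ext ξ i
  simp [adjoint_rowOp, mul_comm]

end RowOperators

/-! ### The Hilbert space of a minimal vector -/

section ConjSpace

variable (B : Type*) {Z : Type u} [NonUnitalCStarAlgebra B] [PartialOrder B] [StarOrderedRing B]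
  [NormedAddCommGroup Z] [NormedSpace ℂ Z] [SMul Bᵐᵒᵖ Z] [CStarModule Bᵐᵒᵖ Z]

/-- The submodule `fixedSpace B e` with the conjugate scalar multiplication. -/
def ConjSpace (e : Z) : Type u := fixedSpace B e

namespace ConjSpace

variable {B} {e : Z}

noncomputable instance : NormedAddCommGroup (ConjSpace B e) :=
  inferInstanceAs (NormedAddCommGroup (fixedSpace B e))

instance [CompleteSpace Z] : CompleteSpace (ConjSpace B e) :=
  (isClosedRightSubmodule_fixedSpace e).1.completeSpace_coe

/-- The identity map to the submodule. -/
noncomputable def toFixed : ConjSpace B e ≃+ fixedSpace B e := AddEquiv.refl _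

noncomputable instance : NormedSpace ℂ (ConjSpace B e) where
  toModule := Module.compHom (fixedSpace B e) (starRingEnd ℂ)
  norm_smul_le c x := by
    change ‖(starRingEnd ℂ c) • toFixed x‖ ≤ ‖c‖ * ‖toFixed x‖
    rw [norm_smul, RCLike.norm_conj]

theorem toFixed_smul (c : ℂ) (x : ConjSpace B e) :
    toFixed (c • x) = (starRingEnd ℂ c) • toFixed x := rfl

theorem norm_toFixed (x : ConjSpace B e) : ‖(toFixed x : Z)‖ = ‖x‖ := rfl

end ConjSpace

variable {B}

/-- The submodule of a minimal vector is the conjugate of a Hilbert space `H`, whose inner product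
computes the ternary product. -/
theorem IsMinimalVector.exists_hilbertSpace [CompleteSpace Z] {e : Z}
    (he : IsMinimalVector B e) :
    ∃ (H : Type u) (_ : NormedAddCommGroup H) (_ : InnerProductSpace ℂ H) (_ : CompleteSpace H)
      (J : H ≃ₗ⋆[ℂ] fixedSpace B e), ∀ x y z : H,
        (J x : Z) <• inn B (J y : Z) (J z : Z) = (inner ℂ x y : ℂ) • (J z : Z) := by
  have hex : ∀ x y : ConjSpace B e, ∃ c : ℂ, ∀ z ∈ fixedSpace B e,
      (x.toFixed : Z) <• inn B (y.toFixed : Z) z = c • z := fun x y =>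
    he.exists_smul x.toFixed.2 y.toFixed.2
  choose lam hlam using hex
  have huniq : ∀ x y c, (x.toFixed : Z) <• inn B (y.toFixed : Z) e = c • e → lam x y = c :=
    fun x y c h => he.eq_of_smul_eq ((hlam x y e he.2.1).symm.trans h)
  let inst : InnerProductSpace ℂ (ConjSpace B e) :=
    { inner := lam
      norm_sq_eq_re_inner := fun x => by
        rw [huniq x x _ (he.2.2 _ x.toFixed.2 e he.2.1), ConjSpace.norm_toFixed]
        exact (RCLike.ofReal_re (K := ℂ) _).symm
      conj_inner_symm := fun x y => by
        -- compare `⟨e, x ⟨y, e⟩⟩` with its adjoint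
        have h1 : lam x y • inn B e e = inn B e (x.toFixed : Z) * inn B (y.toFixed : Z) e := by
          rw [← inn_csmul_right, ← hlam x y e he.2.1, inn_smul_right]
        have h2 : lam y x • inn B e e = inn B e (y.toFixed : Z) * inn B (x.toFixed : Z) e := by
          rw [← inn_csmul_right, ← hlam y x e he.2.1, inn_smul_right]
        have h3 : (starRingEnd ℂ (lam y x)) • inn B e e = lam x y • inn B e e := by
          rw [h1, ← star_inn B e e, starRingEnd_apply, ← star_smul, h2, star_mul, star_inn,
            star_inn]
        exact smul_left_injective ℂ (fun h0 => he.1 (inn_self_eq_zero.mp h0)) h3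
      add_left := fun x y z => huniq _ _ _ <| by
        rw [map_add, Submodule.coe_add, ract_add, hlam x z e he.2.1, hlam y z e he.2.1, add_smul]
      smul_left := fun x y c => huniq _ _ _ <| by
        rw [ConjSpace.toFixed_smul, Submodule.coe_smul, ract_csmul, hlam x y e he.2.1, smul_smul] }
  let J : ConjSpace B e ≃ₗ⋆[ℂ] fixedSpace B e :=
    { ConjSpace.toFixed with map_smul' := fun c x => rfl }
  exact ⟨ConjSpace B e, inferInstance, inst, inferInstance, J, fun x y z => hlam x y _ (J z).2⟩

end ConjSpace

/-! ### Enumeration of a finite set by fibers -/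

section Indexing

/-- A finite set is listed block by block, along the fibers of a map. -/
theorem exists_enumeration_fibers {α β : Type*} (F : Finset α) (p : α → β) :
    ∃ (m : ℕ) (n : Fin m → ℕ) (q : Fin m → β) (e : (k : Fin m) → Fin (n k) → α),
      Function.Injective q ∧ (∀ k, 0 < n k) ∧ (∀ k, Function.Injective (e k)) ∧
      (∀ k i, e k i ∈ F) ∧ (∀ k i, p (e k i) = q k) ∧
      ∀ {M : Type v} [AddCommMonoid M] (g : α → M), ∑ a ∈ F, g a = ∑ k, ∑ i, g (e k i) := by
  classical
  let P := F.image p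
  let q : Fin P.card → β := fun k => P.equivFin.symm k
  let fib : Fin P.card → Finset α := fun k => F.filter fun a => p a = q k
  let e : (k : Fin P.card) → Fin (fib k).card → α := fun k i => (fib k).equivFin.symm i
  have he : ∀ k i, e k i ∈ F ∧ p (e k i) = q k := fun k i =>
    Finset.mem_filter.mp ((fib k).equivFin.symm i).2
  refine ⟨P.card, fun k => (fib k).card, q, e, ?_, fun k => ?_, fun k => ?_, fun k i => (he k i).1,
    fun k i => (he k i).2, fun g => ?_⟩
  · exact Subtype.val_injective.comp P.equivFin.symm.injective
  · obtain ⟨a, ha, hap⟩ := Finset.mem_image.mp (P.equivFin.symm k).2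
    exact Finset.card_pos.mpr ⟨a, Finset.mem_filter.mpr ⟨ha, hap⟩⟩
  · exact Subtype.val_injective.comp (fib k).equivFin.symm.injective
  · rw [← Finset.sum_fiberwise_of_maps_to (t := P) (g := p)
      (fun a ha => Finset.mem_image_of_mem p ha), ← Finset.sum_coe_sort P,
      ← P.equivFin.symm.sum_comp]
    refine Finset.sum_congr rfl fun k _ => ?_
    change ∑ a ∈ fib k, g a = _
    rw [← Finset.sum_coe_sort, ← (fib k).equivFin.symm.sum_comp]

end Indexing

/-! ### Decomposition into blocks -/

section Structure

variable {B : Type*} {Z : Type u} [NonUnitalCStarAlgebra B] [PartialOrder B] [StarOrderedRing B]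
  [NormedAddCommGroup Z] [NormedSpace ℂ Z] [SMul Bᵐᵒᵖ Z] [CStarModule Bᵐᵒᵖ Z]

/-- The coordinate `z ↦ e ⟨f, z⟩`, with values in the submodule of `e`. -/
noncomputable def coord {e : Z} (he : e ∈ fixedSpace B e) (f : Z) : Z →ₗ[ℂ] fixedSpace B e :=
  (rankOne B e f).toLinearMap.codRestrict (fixedSpace B e) fun z =>
    (isClosedRightSubmodule_fixedSpace e).2 e he (inn B f z)

/-- A module with a finite system of minimal vectors `e k i`, where `⟨e k i, e k i⟩` depends on `k`
only, is a direct sum of blocks: the `i`-th row of the `k`-th block of `z` is given by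
`(e k 0) ⟨e k i, z⟩`, an element of the conjugate of the Hilbert space of `e k 0`. -/
theorem exists_linearEquiv_blockSum [CompleteSpace Z] {m : ℕ} {n : Fin m → ℕ} (hn : ∀ k, 0 < n k)
    (e : (k : Fin m) → Fin (n k) → Z) (p : Fin m → B) (hmin : ∀ k i, IsMinimalVector B (e k i))
    (hp : ∀ k i, inn B (e k i) (e k i) = p k)
    (horth : ∀ k i l j, e k i ≠ e l j → inn B (e k i) (e l j) = 0)
    (hinj : ∀ k, Function.Injective (e k)) (hcentral : ∀ k l, k ≠ l → ∀ b, p k * b * p l = 0)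
    (hsum : ∀ z, ∑ k, ∑ i, rankOne B (e k i) (e k i) z = z) :
    ∃ (H : Fin m → Type u) (_ : ∀ k, NormedAddCommGroup (H k))
      (_ : ∀ k, InnerProductSpace ℂ (H k)) (_ : ∀ k, CompleteSpace (H k))
      (T : Z ≃ₗ[ℂ] BlockSum n H), ∀ x y z : Z,
        T (triple B x y z) = blockTriple n H (T x) (T y) (T z) := by
  let e₀ : Fin m → Z := fun k => e k ⟨0, hn k⟩
  have he₀ : ∀ k, e₀ k ∈ fixedSpace B (e₀ k) := fun k => (hmin k _).2.1
  have hp₀ : ∀ k, inn B (e₀ k) (e₀ k) = p k := fun k => hp k _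
  choose H iN iI iC J hJ using fun k => (hmin k ⟨0, hn k⟩).exists_hilbertSpace
  -- elementary relations between the vectors
  have hep : ∀ k i, e k i <• p k = e k i := fun k i => by
    rw [← hp k i]; exact (hmin k i).2.1
  have hpinn : ∀ k i z, p k * inn B (e k i) z = inn B (e k i) z := fun k i z => by
    conv_rhs => rw [← hep k i, inn_smul_left]
    rw [← hp k i, star_inn]
  have hinnp : ∀ k i z, inn B z (e k i) * p k = inn B z (e k i) := fun k i z => by
    rw [← inn_smul_right, hep]
  have hne : ∀ k i l j, k ≠ l → inn B (e k i) (e l j) = 0 := fun k i l j hkl => by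
    rw [← hpinn k i, ← hinnp l j, ← mul_assoc]
    exact hcentral k l hkl _
  have hcut : ∀ k l, k ≠ l → ∀ b j y, e₀ k <• b <• inn B y (e l j) = 0 := fun k l hkl b j y => by
    rw [← ract_mul, ← hinnp l j, ← inn_self_eq_zero (B := B), inn_smul_left, inn_smul_right, hp₀,
      ← mul_assoc b, ← mul_assoc (p k), hcentral k l hkl, mul_zero]
  let φ : (k : Fin m) → Fin (n k) → Z →ₗ[ℂ] fixedSpace B (e₀ k) := fun k i =>
    coord (he₀ k) (e k i)
  have hφ : ∀ k i z, (φ k i z : Z) = e₀ k <• inn B (e k i) z := fun _ _ _ => rfl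
  have hφφ : ∀ k i y z, inn B (φ k i y : Z) (φ k i z) = inn B y (e k i) * inn B (e k i) z :=
    fun k i y z => by
      rw [hφ, hφ, inn_smul_left, inn_smul_right, hp₀, hpinn, star_inn]
  have htriple : ∀ k i x y z, (φ k i (triple B x y z) : Z) =
      ∑ j, (φ k i x : Z) <• inn B (φ k j y : Z) (φ k j z) := fun k i x y z => by
    have hinn : inn B y z = ∑ l, ∑ j, inn B y (e l j) * inn B (e l j) z := by
      conv_lhs => rw [← hsum z]
      simp only [inn_sum_right, rankOne_apply, inn_smul_right]
    rw [hφ, triple, inn_smul_right, ract_mul, hinn, ract_sum, Finset.sum_eq_single k]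
    · rw [ract_sum]
      exact Finset.sum_congr rfl fun j _ => by rw [hφφ, hφ]
    · intro l _ hlk
      rw [ract_sum]
      refine Finset.sum_eq_zero fun j _ => ?_
      rw [ract_mul, hcut k l hlk.symm, zero_ract]
    · exact fun h => absurd (Finset.mem_univ k) h
  let ψ : (k : Fin m) → Fin (n k) → Z →ₗ⋆[ℂ] H k := fun k i => (J k).symm.toLinearMap.comp (φ k i)
  have hJψ : ∀ k i z, J k (ψ k i z) = φ k i z := fun k i z => (J k).apply_symm_apply _
  let T₀ : Z →ₗ[ℂ] BlockSum n H :=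
    { toFun := fun z k => rowOp fun i => ψ k i z
      map_add' := fun x y => by
        ext k ξ i
        simp
      map_smul' := fun c x => by
        ext k ξ i
        simp [mul_comm] }
  have hT₀ : ∀ z k, T₀ z k = rowOp fun i => ψ k i z := fun _ _ => rfl
  have hTinj : Function.Injective T₀ := by
    rw [injective_iff_map_eq_zero]
    intro z hz
    have h1 : ∀ k i, (φ k i z : Z) = 0 := fun k i => by
      have h2 : (fun i => ψ k i z) = fun i => ψ k i 0 :=
        rowOp_injective ((hT₀ z k).symm.trans (by rw [hz, ← hT₀, map_zero]))
      have h3 : ψ k i z = ψ k i 0 := congrFun h2 i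
      rw [← hJψ, h3, hJψ, map_zero]; rfl
    rw [← hsum z]
    refine Finset.sum_eq_zero fun k _ => Finset.sum_eq_zero fun i _ => ?_
    rw [rankOne_apply, ← hpinn k i, ← hp₀, ← inn_smul_right, ← hφ, h1, inn_zero_right, ract_zero]
  have hTsurj : Function.Surjective T₀ := fun A => by
    choose h hh using fun k => rowOp_surjective (A k)
    refine ⟨∑ l, ∑ j, e l j <• inn B (e₀ l) (J l (h l j)), funext fun k => ?_⟩
    rw [hT₀, ← hh k]
    congr 1
    ext i
    refine (J k).injective (Subtype.ext ?_)
    rw [hJψ, hφ, inn_sum_right, Finset.sum_eq_single k, inn_sum_right, Finset.sum_eq_single i,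
      inn_smul_right, hp, hpinn]
    · exact (J k (h k i)).2
    · intro j _ hji
      rw [inn_smul_right, horth k i k j fun h => hji (hinj k h).symm, zero_mul]
    · exact fun h => absurd (Finset.mem_univ i) h
    · intro l _ hlk
      rw [inn_sum_right]
      refine Finset.sum_eq_zero fun j _ => ?_
      rw [inn_smul_right, hne k i l j hlk.symm, zero_mul]
    · exact fun h => absurd (Finset.mem_univ k) h
  refine ⟨H, iN, iI, iC, LinearEquiv.ofBijective T₀ ⟨hTinj, hTsurj⟩, fun x y z => ?_⟩
  change T₀ _ = blockTriple n H (T₀ x) (T₀ y) (T₀ z)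
  funext k
  rw [blockTriple, hT₀, hT₀, hT₀, hT₀, rowOp_triple]
  congr 1
  ext i
  refine (J k).injective (Subtype.ext ?_)
  rw [hJψ, htriple, map_sum, AddSubmonoidClass.coe_finsetSum]
  refine Finset.sum_congr rfl fun j _ => ?_
  rw [map_smulₛₗ, Submodule.coe_smul, inner_conj_symm, ← hJ, hJψ, hJψ, hJψ]

/-- If all maximal submodules are finitely generated, then the module is a direct sum of blocks. -/
theorem exists_linearEquiv_blockSum_of_isAlgFinitelyGenerated [CompleteSpace Z]
    (h : ∀ W : Submodule ℂ Z, IsMaximalRightSubmodule B W → IsAlgFinitelyGenerated B W) :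
    ∃ (m : ℕ) (n : Fin m → ℕ) (H : Fin m → Type u)
      (_ : ∀ k, NormedAddCommGroup (H k)) (_ : ∀ k, InnerProductSpace ℂ (H k))
      (_ : ∀ k, CompleteSpace (H k)), 0 < m ∧ (∀ k, 0 < n k) ∧
      ∃ T : Z ≃ₗ[ℂ] BlockSum n H, ∀ x y z : Z,
        T (triple B x y z) = blockTriple n H (T x) (T y) (T z) := by
  rcases subsingleton_or_nontrivial Z with hZ | hZ
  · -- the zero module is a block on the zero Hilbert space
    refine ⟨1, fun _ => 1, fun _ => EuclideanSpace ℂ PEmpty.{u + 1}, fun _ => inferInstance,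
      fun _ => inferInstance, fun _ => inferInstance, one_pos, fun _ => one_pos, 0,
      fun x y z => Subsingleton.elim _ _⟩
  obtain ⟨F, hF, hFsum⟩ := exists_isMinimalSystem_sum_rankOne_eq h
  obtain ⟨m, n, q, e, hq, hn, hinj, heF, hpe, hsum⟩ :=
    exists_enumeration_fibers.{u} F fun e => inn B e e
  have hsum' : ∀ z, ∑ k, ∑ i, rankOne B (e k i) (e k i) z = z := fun z => by
    rw [← hsum fun e => rankOne B e e z, hFsum]
  have hm : 0 < m := by
    rw [Nat.pos_iff_ne_zero]
    rintro rfl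
    obtain ⟨z, hz⟩ := exists_ne (0 : Z)
    exact hz ((hsum' z).symm.trans (by simp))
  obtain ⟨H, iN, iI, iC, hT⟩ := exists_linearEquiv_blockSum hn e q
    (fun k i => hF.isMinimalVector _ (heF k i)) hpe
    (fun k i l j hne => hF.inn_eq_zero _ (heF k i) _ (heF l j) hne) hinj
    (fun k l hkl => by
      have := hF.eq_or_forall_mul_eq_zero _ (heF k ⟨0, hn k⟩) _ (heF l ⟨0, hn l⟩)
      rw [hpe, hpe] at this
      exact this.resolve_left fun h => hkl (hq h)) hsum'
  exact ⟨m, n, H, iN, iI, iC, hm, hn, hT⟩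

end Structure

/-! ### Submodules of a sum of blocks -/

section FiniteRank

variable {H : Type*} [NormedAddCommGroup H] [InnerProductSpace ℂ H] [CompleteSpace H]

/-- An operator into a finite dimensional space is `∑ j, (A g j) ⟪g j, ·⟫`, for an orthonormal basis
`g` of the range of its adjoint. -/
theorem exists_sum_rankOne_eq {E : Type*} [NormedAddCommGroup E] [InnerProductSpace ℂ E]
    [FiniteDimensional ℂ E] [CompleteSpace E] (A : H →L[ℂ] E) :
    ∃ (d : ℕ) (g : Fin d → H), (∀ j, ‖g j‖ = 1) ∧
      A = ∑ j, InnerProductSpace.rankOne ℂ (A (g j)) (g j) := by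
  let K := (ContinuousLinearMap.adjoint A).range
  let b := stdOrthonormalBasis ℂ K
  have hK : Kᗮ = A.ker := by
    rw [ContinuousLinearMap.orthogonal_range, ContinuousLinearMap.adjoint_adjoint]
  have hA : A = A ∘L K.starProjection := by
    ext1 ξ
    have h1 : ξ - K.starProjection ξ ∈ A.ker := by
      rw [← hK]
      exact K.sub_starProjection_mem_orthogonal ξ
    rw [LinearMap.mem_ker, map_sub, sub_eq_zero] at h1
    exact h1
  refine ⟨_, fun j => b j, fun j => b.norm_eq_one j, ?_⟩
  conv_lhs => rw [hA, b.starProjection_eq_sum_rankOne]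
  ext1 ξ
  simp

end FiniteRank

section BlockSum

variable {m : ℕ} (n : Fin m → ℕ) (H : Fin m → Type u) [∀ k, NormedAddCommGroup (H k)]
  [∀ k, InnerProductSpace ℂ (H k)] [∀ k, CompleteSpace (H k)]

theorem blockTriple_single (x : BlockSum n H) (k : Fin m)
    (y z : H k →L[ℂ] EuclideanSpace ℂ (Fin (n k))) :
    blockTriple n H x (Pi.single k y) (Pi.single k z) =
      Pi.single k (x k ∘L ContinuousLinearMap.adjoint y ∘L z) := by
  funext l
  rcases eq_or_ne l k with rfl | h
  · simp [blockTriple]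
  · simp [blockTriple, h]

end BlockSum

section FinitelyGenerated

variable {B : Type*} {Z : Type u} [NonUnitalCStarAlgebra B] [PartialOrder B]
  [NormedAddCommGroup Z] [NormedSpace ℂ Z] [SMul Bᵐᵒᵖ Z] [CStarModule Bᵐᵒᵖ Z]

/-- Right submodules of a direct sum of blocks are finitely generated. With unit vectors `h k` of
the nonzero Hilbert spaces, generators are obtained from a basis of the finite dimensional space of
those `(v k)` for which the element with the blocks `v k ⟪h k, ·⟫` lies in the submodule. -/
theorem isAlgFinitelyGenerated_of_linearEquiv_blockSum {m : ℕ} {n : Fin m → ℕ}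
    (hn : ∀ k, 0 < n k) {H : Fin m → Type u} [∀ k, NormedAddCommGroup (H k)]
    [∀ k, InnerProductSpace ℂ (H k)] [∀ k, CompleteSpace (H k)] (T : Z ≃ₗ[ℂ] BlockSum n H)
    (hT : ∀ x y z : Z, T (triple B x y z) = blockTriple n H (T x) (T y) (T z))
    {W : Submodule ℂ Z} (hW : ∀ z ∈ W, ∀ b : B, z <• b ∈ W) : IsAlgFinitelyGenerated B W := by
  have hh : ∀ k, ∃ h : H k, Nontrivial (H k) → ‖h‖ = 1 := fun k => by
    rcases subsingleton_or_nontrivial (H k) with hk | hk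
    · exact ⟨0, fun h => absurd h (not_nontrivial _)⟩
    · obtain ⟨x, hx⟩ := exists_ne (0 : H k)
      exact ⟨_, fun _ => norm_smul_inv_norm (𝕜 := ℂ) hx⟩
  choose h hh using hh
  let D : ((k : Fin m) → EuclideanSpace ℂ (Fin (n k))) →ₗ[ℂ] Z :=
    { toFun := fun v => T.symm fun k => InnerProductSpace.rankOne ℂ (v k) (h k)
      map_add' := fun v w => by
        rw [← map_add]; congr 1; funext k; simp
      map_smul' := fun c v => by
        rw [RingHom.id_apply, ← map_smul]; congr 1; funext k; simp }
  have hD : ∀ k (v : EuclideanSpace ℂ (Fin (n k))), D (Pi.single k v) =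
      T.symm (Pi.single k (InnerProductSpace.rankOne ℂ v (h k))) := fun k v => by
    refine congrArg T.symm (funext fun l => ?_)
    rcases eq_or_ne l k with rfl | hl
    · simp
    · simp [hl]
  -- `g ⟪h, ·⟫ = y⋆ z` for `y = f ⟪g, ·⟫` and `z = f ⟪h, ·⟫`, where `f` is a unit vector
  have hact : ∀ k (g g' : H k), ∃ b : B, ∀ x : Z, x <• b =
      T.symm (Pi.single k (InnerProductSpace.rankOne ℂ (T x k g) g')) := fun k g g' => by
    let f : EuclideanSpace ℂ (Fin (n k)) := EuclideanSpace.single ⟨0, hn k⟩ 1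
    have hf : inner ℂ f f = (1 : ℂ) := by
      rw [inner_self_eq_norm_sq_to_K]; simp [f]
    refine ⟨inn B (T.symm (Pi.single k (InnerProductSpace.rankOne ℂ f g)))
      (T.symm (Pi.single k (InnerProductSpace.rankOne ℂ f g'))), fun x => ?_⟩
    rw [LinearEquiv.eq_symm_apply]
    refine (hT _ _ _).trans ?_
    rw [LinearEquiv.apply_symm_apply, LinearEquiv.apply_symm_apply, blockTriple_single,
      InnerProductSpace.adjoint_rankOne, InnerProductSpace.rankOne_comp_rankOne, hf, one_smul,
      InnerProductSpace.comp_rankOne]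
  let W' := W.comap D
  let b := Module.finBasis ℂ W'
  let R : Submodule ℂ Z := LinearMap.range
    (∑ i, (ractCLM B (D (b i))).toLinearMap ∘ₗ LinearMap.proj i :
      (Fin (Module.finrank ℂ W') → B) →ₗ[ℂ] Z)
  have hR : ∀ z, z ∈ R ↔ ∃ a : Fin (Module.finrank ℂ W') → B, ∑ i, D (b i) <• a i = z :=
    fun z => by simp [R]
  have hDR : ∀ v ∈ W', ∀ a : B, D v <• a ∈ R := fun v hv a => by
    refine (hR _).mpr ⟨fun i => b.repr ⟨v, hv⟩ i • a, ?_⟩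
    have hv' : v = ∑ i, b.repr ⟨v, hv⟩ i • (b i : (k : Fin m) → EuclideanSpace ℂ (Fin (n k))) := by
      have := congrArg Subtype.val (b.sum_repr ⟨v, hv⟩)
      rw [AddSubmonoidClass.coe_finsetSum] at this
      exact this.symm
    conv_rhs => rw [hv', map_sum, sum_ract]
    refine Finset.sum_congr rfl fun i _ => ?_
    rw [map_smul, ract_csmul, ract_csmul_right]
  refine ⟨_, fun i => D (b i), fun i => (b i).2, fun z hz => ?_⟩
  suffices hzR : z ∈ R by
    obtain ⟨a, ha⟩ := (hR z).mp hzR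
    exact ⟨0, a, by simp [ha]⟩
  have hz' : z = ∑ k, T.symm (Pi.single k (T z k)) := by
    rw [← map_sum, Finset.univ_sum_single, LinearEquiv.symm_apply_apply]
  rw [hz']
  refine R.sum_mem fun k _ => ?_
  obtain ⟨d, g, hg, hsum⟩ := exists_sum_rankOne_eq (T z k)
  have hsplit : T.symm (Pi.single k (T z k)) =
      ∑ j, T.symm (Pi.single k (InnerProductSpace.rankOne ℂ (T z k (g j)) (g j))) := by
    conv_lhs => rw [hsum]
    rw [← map_sum]
    exact congrArg T.symm (map_sum (AddMonoidHom.single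
      (fun k => H k →L[ℂ] EuclideanSpace ℂ (Fin (n k))) k) _ _)
  rw [hsplit]
  refine R.sum_mem fun j _ => ?_
  have hk : Nontrivial (H k) := ⟨g j, 0, norm_ne_zero_iff.mp (by rw [hg]; exact one_ne_zero)⟩
  obtain ⟨a, ha⟩ := hact k (g j) (h k)
  obtain ⟨a', ha'⟩ := hact k (h k) (g j)
  have hmem : (Pi.single k (T z k (g j)) : (k : Fin m) → EuclideanSpace ℂ (Fin (n k))) ∈ W' := by
    rw [Submodule.mem_comap, hD, ← ha]
    exact hW z hz a
  have := hDR _ hmem a'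
  rw [ha', hD, LinearEquiv.apply_symm_apply, Pi.single_eq_same, InnerProductSpace.rankOne_apply,
    inner_self_eq_norm_sq_to_K, hh k hk] at this
  simpa using this

end FinitelyGenerated

end RightHilbert

theorem theorem3p1 (B : Type v) (Z : Type u)
    [NonUnitalCStarAlgebra B] [PartialOrder B] [StarOrderedRing B]
    [NormedAddCommGroup Z] [NormedSpace ℂ Z] [CompleteSpace Z]
    [SMul Bᵐᵒᵖ Z] [CStarModule Bᵐᵒᵖ Z] :
    (∀ W : Submodule ℂ Z, RightHilbert.IsMaximalRightSubmodule B W →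
        RightHilbert.IsAlgFinitelyGenerated B W) ↔
      ∃ (m : ℕ) (n : Fin m → ℕ) (H : Fin m → Type u)
        (_ : ∀ k, NormedAddCommGroup (H k)) (_ : ∀ k, InnerProductSpace ℂ (H k))
        (_ : ∀ k, CompleteSpace (H k)),
        0 < m ∧ (∀ k, 0 < n k) ∧
        ∃ T : Z ≃ₗ[ℂ] RightHilbert.BlockSum n H, ∀ x y z : Z,
          T (RightHilbert.triple B x y z) = RightHilbert.blockTriple n H (T x) (T y) (T z) := by
  refine ⟨RightHilbert.exists_linearEquiv_blockSum_of_isAlgFinitelyGenerated, ?_⟩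
  rintro ⟨m, n, H, _, _, _, -, hn, T, hT⟩ W hW
  exact RightHilbert.isAlgFinitelyGenerated_of_linearEquiv_blockSum hn T hT hW.prop.1.2
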